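/- **Theorem (completeness).** Let $k,n\ge 1$. The teleportation-based ping-pong test consists of $n$ independent and identically distributed executions. In one execution the verifier samples, uniformly and independently, a depth $\kappa\in\{1,\dots,k\}$, a sequence $C_1,\dots,C_\kappa$ of single-qubit Clifford gates (unitary channels, taken modulo global phase), and one of the six Pauli eigenstates $|\psi\rangle$. Honest provers transform the input into $C_\kappa\circ M_\kappa\circ\cdots\circ C_1\circ M_1(|\psi\rangle\langle\psi|)$, where the completely positive trace-preserving qubit map $M_j$ is the (noisy) teleportation-and-memory operation of round $j$, and the verifier measures $\{\Pi,\mathbb 1-\Pi\}$ with $\Pi=C_\kappa\circ\cdots\circ C_1(|\psi\rangle\langle\psi|)$, setting $v=1$ on outcome $\Pi$ and $v=0$ otherwise. The winning rate is $R=\frac1n\sum_{i=1}^n v^i$. Assume that all rounds have the same average fidelity, i.e. for every $j=1,\dots,k$ and every Clifford gate $C$, $$\bar\mu=\int \mathrm d\psi\ \mathrm{Tr}\big[\,C\circ M_j(|\psi\rangle\langle\psi|)\cdot C(|\psi\rangle\langle\psi|)\big],$$ where $\mathrm d\psi$ is the Haar probability measure on pure qubit states. Let $h_k(x)=\frac{x(x^k-1)}{k(x-1)}$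 for $x\ne1$ and $h_k(1)=1$; this is a bijection of $[0,1]$, with inverse $h_k^{-1}$. Let $t\in(\tfrac56,1]$ be a winning threshold and $\varepsilon>0$. If $\bar\mu\ge h_k^{-1}(t)+\varepsilon$, then $$\Pr[R\ge t]\ \ge\ 1-e^{-n\varepsilon^2}.$$ -/

import Mathlib

open scoped ComplexOrder Matrix

noncomputable section

namespace PingPong

/-! ### Qubits, pure states and channels -/

/-- The Hilbert space of a qubit. -/
abbrev Qubit : Type := EuclideanSpace ℂ (Fin 2)

/-- Operators on a qubit. -/
abbrev Op : Type := Matrix (Fin 2) (Fin 2) ℂ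

/-- Pure qubit states, given by unit vectors. -/
abbrev PureState : Type := Metric.sphere (0 : Qubit) 1

/-- The rank-one projector `|ψ⟩⟨ψ|`. -/
def ketbra (ψ : PureState) : Op := Matrix.vecMulVec (ψ : Qubit).ofLp (star (ψ : Qubit).ofLp)

/-- `id_m ⊗ L`: the map `L` applied to each `2 × 2` block of an operator on `ℂ^m ⊗ ℂ^2`. -/
def ampliation (m : ℕ) (L : Op →ₗ[ℂ] Op) (A : Matrix (Fin m × Fin 2) (Fin m × Fin 2) ℂ) :
    Matrix (Fin m × Fin 2) (Fin m × Fin 2) ℂ :=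
  Matrix.of fun x y => L (Matrix.of fun a b => A (x.1, a) (y.1, b)) x.2 y.2

/-- A qubit channel: a completely positive trace-preserving linear map. -/
structure QubitChannel where
  toLin : Op →ₗ[ℂ] Op
  trace_preserving : ∀ A : Op, (toLin A).trace = A.trace
  completely_positive : ∀ (m : ℕ) (A : Matrix (Fin m × Fin 2) (Fin m × Fin 2) ℂ),
    A.PosSemidef → (ampliation m toLin A).PosSemidef

instance : CoeFun QubitChannel (fun _ => Op → Op) := ⟨fun Λ => Λ.toLin⟩

namespace QubitChannel

/-- The identity channel. -/
def id : QubitChannel where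
  toLin := LinearMap.id
  trace_preserving _ := rfl
  completely_positive _ _ hA := hA

/-- Composition `Λ ∘ Λ'` (first `Λ'`, then `Λ`). -/
def comp (Λ Λ' : QubitChannel) : QubitChannel where
  toLin := Λ.toLin ∘ₗ Λ'.toLin
  trace_preserving A := (Λ.trace_preserving _).trans (Λ'.trace_preserving A)
  completely_positive m A hA := Λ.completely_positive m _ (Λ'.completely_positive m A hA)

/-- The unitary channel `ρ ↦ U ρ U†`. -/
def ofUnitary (U : Matrix.unitaryGroup (Fin 2) ℂ) : QubitChannel where
  toLin :=
    { toFun := fun A => (U : Op) * A * (U : Op)ᴴ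
      map_add' := fun A B => by rw [mul_add, add_mul]
      map_smul' := fun c A => by simp }
  trace_preserving A := by
    have h : (U : Op)ᴴ * (U : Op) = 1 := Matrix.mem_unitaryGroup_iff'.mp U.2
    change ((U : Op) * A * (U : Op)ᴴ).trace = A.trace
    rw [Matrix.trace_mul_comm, ← mul_assoc, h, one_mul]
  completely_positive m A hA := by
    have h := hA.mul_mul_conjTranspose_same
      (Matrix.of fun x y : Fin m × Fin 2 => if x.1 = y.1 then (U : Op) x.2 y.2 else 0)
    convert h using 1
    ext ⟨i, a⟩ ⟨j, b⟩
    simp [ampliation, Matrix.mul_apply, Fintype.sum_prod_type, Matrix.conjTranspose_apply,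
      apply_ite, ite_mul, Finset.sum_ite_eq]

end QubitChannel

/-- Average fidelity `∫ dψ Tr[Λ'(|ψ⟩⟨ψ|) Λ(|ψ⟩⟨ψ|)]` of the channel `Λ'` to the channel `Λ`.
Here `dψ` is the Haar (uniform) probability measure on pure states: the symbol `⨍` normalizes the
surface measure on the unit sphere of `ℂ²` to total mass one. -/
def avgFidelity (Λ' Λ : QubitChannel) : ℝ :=
  ⨍ ψ : PureState, (Λ' (ketbra ψ) * Λ (ketbra ψ)).trace.re
    ∂(MeasureTheory.volume : MeasureTheory.Measure Qubit).toSphere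

/-! ### Pauli eigenstates and Clifford gates -/

/-- The Pauli matrices `X`, `Y`, `Z`. -/
def pauli : Fin 3 → Op :=
  ![!![0, 1; 1, 0], !![0, -Complex.I; Complex.I, 0], !![1, 0; 0, -1]]

/-- The vectors `|0⟩, |1⟩, |+⟩, |-⟩, |+i⟩, |-i⟩`. -/
def pauliKet : Fin 6 → Qubit :=
  ![!₂[1, 0], !₂[0, 1],
    !₂[(√2 : ℂ)⁻¹, (√2 : ℂ)⁻¹], !₂[(√2 : ℂ)⁻¹, -(√2 : ℂ)⁻¹],
    !₂[(√2 : ℂ)⁻¹, (√2 : ℂ)⁻¹ * Complex.I], !₂[(√2 : ℂ)⁻¹, -((√2 : ℂ)⁻¹ * Complex.I)]]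

lemma norm_pauliKet (s : Fin 6) : ‖pauliKet s‖ = 1 := by
  have h2 : ((√2 : ℝ)⁻¹) ^ 2 = 1 / 2 := by
    rw [inv_pow, Real.sq_sqrt (by norm_num)]; norm_num
  rw [EuclideanSpace.norm_eq, Real.sqrt_eq_one]
  fin_cases s <;> simp [pauliKet] <;> norm_num

/-- The six Pauli eigenstates (pairwise distinct as states), as unit vectors. -/
def pauliState (s : Fin 6) : PureState := ⟨pauliKet s, by simp [norm_pauliKet]⟩

/-- The single-qubit Clifford gates: the unitary channels `ρ ↦ U ρ U†` for which conjugation by `U`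
sends each Pauli matrix to a Pauli matrix up to sign. Unitaries that differ by a global phase give
the same gate. -/
def cliffordGates : Set QubitChannel :=
  {Λ | ∃ U : Matrix.unitaryGroup (Fin 2) ℂ, Λ = QubitChannel.ofUnitary U ∧
    ∀ a, ∃ b, (U : Op) * pauli a * (U : Op)ᴴ = pauli b ∨
      (U : Op) * pauli a * (U : Op)ᴴ = -pauli b}

lemma op_eq_pauli (A : Op) :
    A = ((A 0 0 + A 1 1) / 2) • (1 : Op) + ((A 0 1 + A 1 0) / 2) • pauli 0
      + (Complex.I * (A 0 1 - A 1 0) / 2) • pauli 1 + ((A 0 0 - A 1 1) / 2) • pauli 2 := by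
  have hI : Complex.I * Complex.I = -1 := Complex.I_mul_I
  ext i j
  fin_cases i <;> fin_cases j <;> simp [pauli]
  · ring
  · linear_combination (A 0 1 - A 1 0) / 2 * hI
  · linear_combination (A 1 0 - A 0 1) / 2 * hI
  · ring

lemma finite_cliffordGates : cliffordGates.Finite := by
  let f : QubitChannel → Fin 3 → Op := fun Λ a => Λ (pauli a)
  have hfin : (Set.range pauli ∪ Set.range fun b => -pauli b).Finite :=
    (Set.finite_range _).union (Set.finite_range _)
  refine Set.Finite.of_finite_image (f := f) ((Set.Finite.pi fun _ => hfin).subset ?_) ?_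
  · rintro _ ⟨Λ, ⟨U, rfl, hU⟩, rfl⟩ a -
    obtain ⟨b, h | h⟩ := hU a
    · exact Or.inl ⟨b, h.symm⟩
    · exact Or.inr ⟨b, h.symm⟩
  · rintro Λ ⟨U, rfl, -⟩ Λ' ⟨V, rfl, -⟩ h
    have h1 : ∀ W : Matrix.unitaryGroup (Fin 2) ℂ, (QubitChannel.ofUnitary W) (1 : Op) = 1 := by
      intro W
      have hW : (W : Op) * (W : Op)ᴴ = 1 := Matrix.mem_unitaryGroup_iff.mp W.2
      change (W : Op) * 1 * (W : Op)ᴴ = 1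
      rw [mul_one, hW]
    have hl : (QubitChannel.ofUnitary U).toLin = (QubitChannel.ofUnitary V).toLin := by
      refine LinearMap.ext fun A => ?_
      have h0 := congrFun h 0
      have h2 := congrFun h 1
      have h3 := congrFun h 2
      simp only [f] at h0 h2 h3
      rw [op_eq_pauli A]
      simp only [map_add, map_smul, h1, h0, h2, h3]
    generalize QubitChannel.ofUnitary U = Λ at hl
    generalize QubitChannel.ofUnitary V = Λ' at hl
    cases Λ
    cases Λ'
    cases hl
    rfl

instance : Fintype cliffordGates := finite_cliffordGates.fintype

instance : Nonempty cliffordGates :=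
  ⟨⟨QubitChannel.ofUnitary 1, 1, rfl, fun a => ⟨a, Or.inl (by simp)⟩⟩⟩

/-! ### The teleportation-based ping-pong test with honest provers -/

/-- The composition `Λ_κ ∘ ⋯ ∘ Λ_1` of `κ` channels. -/
def compRounds : (κ : ℕ) → (Fin κ → QubitChannel) → QubitChannel
  | 0, _ => QubitChannel.id
  | κ + 1, Λ => (Λ (Fin.last κ)).comp (compRounds κ fun j => Λ j.castSucc)

/-- The operation `C_κ ∘ M_κ ∘ ⋯ ∘ C_1 ∘ M_1` performed by honest provers in an execution of depth
`κ`, where `M j` is the (noisy) teleportation-and-memory channel of round `j = 1, 2, …`. -/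
def testChannel (M : ℕ → QubitChannel) {κ : ℕ} (c : Fin κ → cliffordGates) : QubitChannel :=
  compRounds κ fun j => ((c j : QubitChannel)).comp (M (j + 1))

/-- The ideal operation `C_κ ∘ ⋯ ∘ C_1`. -/
def idealChannel {κ : ℕ} (c : Fin κ → cliffordGates) : QubitChannel :=
  compRounds κ fun j => c j

/-- The verifier's two-outcome measurement `{Π, 1 - Π}` with `Π = G(|ψ⟩⟨ψ|)`; `true` is "accept". -/
def povm (G : QubitChannel) (ψ : PureState) (v : Bool) : Op :=
  if v then G (ketbra ψ) else 1 - G (ketbra ψ)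

open scoped MatrixOrder Matrix.Norms.L2Operator in
lemma trace_mul_nonneg {A B : Op} (hA : A.PosSemidef) (hB : B.PosSemidef) :
    0 ≤ (A * B).trace := by
  obtain ⟨C, rfl⟩ := CStarAlgebra.nonneg_iff_eq_star_mul_self.mp hB.nonneg
  rw [← mul_assoc, Matrix.trace_mul_comm, ← mul_assoc]
  exact (hA.mul_mul_conjTranspose_same C).trace_nonneg

lemma QubitChannel.posSemidef (Λ : QubitChannel) {A : Op} (hA : A.PosSemidef) :
    (Λ A).PosSemidef := by
  have h := Λ.completely_positive 1 (A.submatrix Prod.snd Prod.snd) (hA.submatrix _)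
  exact h.submatrix fun a : Fin 2 => ((0 : Fin 1), a)

lemma posSemidef_ketbra (ψ : PureState) : (ketbra ψ).PosSemidef :=
  Matrix.posSemidef_vecMulVec_self_star _

lemma trace_ketbra (ψ : PureState) : (ketbra ψ).trace = 1 := by
  have h : ‖(ψ : Qubit)‖ = 1 := by simp
  have h2 := EuclideanSpace.inner_eq_star_dotProduct (ψ : Qubit) (ψ : Qubit)
  rw [inner_self_eq_norm_sq_to_K, h] at h2
  rw [ketbra, Matrix.trace_vecMulVec]
  simpa using h2.symm

lemma posSemidef_povm (G : QubitChannel) (ψ : PureState) (v : Bool) :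
    (povm G ψ v).PosSemidef := by
  have hG := G.posSemidef (posSemidef_ketbra ψ)
  cases v
  · have htr : (G (ketbra ψ)).trace = 1 := (G.trace_preserving _).trans (trace_ketbra ψ)
    rw [Matrix.trace_fin_two] at htr
    have h := hG.transpose.mul_mul_conjTranspose_same (!![0, 1; -1, 0] : Op)
    have he : povm G ψ false = !![0, 1; -1, 0] * (G (ketbra ψ))ᵀ * (!![0, 1; -1, 0] : Op)ᴴ := by
      ext i j
      fin_cases i <;> fin_cases j <;>
        simp [povm, Matrix.mul_apply, Fin.sum_univ_two, -Matrix.cons_mul]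
      · linear_combination -htr
      · linear_combination -htr
    rw [he]
    exact h
  · exact hG

/-- The law of the verdict in one execution, given the channel `S` performed by the provers, the
ideal channel `G` and the input state `ψ`: outcome `v` has probability `Tr[S(|ψ⟩⟨ψ|) Π_v]`. -/
def verdictLaw (S G : QubitChannel) (ψ : PureState) : PMF Bool :=
  PMF.ofFintype (fun v => ENNReal.ofReal (S (ketbra ψ) * povm G ψ v).trace.re) (by
    have hS := S.posSemidef (posSemidef_ketbra ψ)
    have hnn : ∀ v, 0 ≤ (S (ketbra ψ) * povm G ψ v).trace.re := fun v =>
      (Complex.nonneg_iff.mp (trace_mul_nonneg hS (posSemidef_povm G ψ v))).1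
    rw [Fintype.sum_bool, ← ENNReal.ofReal_add (hnn _) (hnn _), ← Complex.add_re,
      ← Matrix.trace_add, ← mul_add]
    simp [povm, S.trace_preserving, trace_ketbra])

/-- The law of the verdict of a single execution: the verifier samples uniformly and independently
a depth `κ ∈ {1, …, k}`, `κ` Clifford gates and one of the six Pauli eigenstates, and measures. -/
def executionLaw (k : ℕ) (hk : 1 ≤ k) (M : ℕ → QubitChannel) : PMF Bool :=
  (PMF.uniformOfFinset (Finset.Icc 1 k) (Finset.nonempty_Icc.mpr hk)).bind fun κ =>
    (PMF.uniformOfFintype (Fin κ → cliffordGates)).bind fun c =>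
      (PMF.uniformOfFintype (Fin 6)).bind fun s =>
        verdictLaw (testChannel M c) (idealChannel c) (pauliState s)

/-- The joint law of the verdicts of `n` independent executions. -/
def testLaw (k : ℕ) (hk : 1 ≤ k) (M : ℕ → QubitChannel) (n : ℕ) :
    MeasureTheory.Measure (Fin n → Bool) :=
  MeasureTheory.Measure.pi fun _ => (executionLaw k hk M).toMeasure

/-- The winning rate `R = (1/n) ∑ v_i`, where "accept" counts as `1` and "reject" as `0`. -/
def winningRate {n : ℕ} (v : Fin n → Bool) : ℝ :=
  (∑ i, if v i then (1 : ℝ) else 0) / n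

/-! ### The function `h_k` and its inverse -/

/-- `h_k(μ) = μ (μ^k - 1) / (k (μ - 1))`, extended continuously by `h_k(1) = 1`. -/
def h (k : ℕ) (μ : ℝ) : ℝ :=
  if μ = 1 then 1 else μ * (μ ^ k - 1) / (k * (μ - 1))

/-- The inverse of the bijection `h_k : [0, 1] → [0, 1]`. -/
def hInv (k : ℕ) (t : ℝ) : ℝ := Function.invFunOn (h k) (Set.Icc 0 1) t

lemma h_eq_sum {k : ℕ} (hk : 1 ≤ k) (μ : ℝ) : h k μ = (∑ i ∈ Finset.range k, μ ^ (i + 1)) / k := by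
  have hk0 : (k : ℝ) ≠ 0 := by positivity
  unfold h
  split_ifs with h1
  · subst h1
    simp [hk0]
  · have h2 : μ - 1 ≠ 0 := sub_ne_zero.mpr h1
    simp only [pow_succ']
    rw [← Finset.mul_sum, geom_sum_eq h1]
    field_simp

/-- `h_k` is a bijection of `[0, 1]`, so that `hInv` is its inverse there. -/
lemma bijOn_h {k : ℕ} (hk : 1 ≤ k) : Set.BijOn (h k) (Set.Icc 0 1) (Set.Icc 0 1) := by
  have hk0 : (0 : ℝ) < k := by positivity
  have he : h k = fun μ : ℝ => (∑ i ∈ Finset.range k, μ ^ (i + 1)) / k := funext fun μ => h_eq_sum hk μ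
  have h0 : h k 0 = 0 := by simp [h_eq_sum hk]
  have h1 : h k 1 = 1 := by simp [h]
  have hmono : StrictMonoOn (h k) (Set.Icc 0 1) := by
    intro x hx y _ hxy
    rw [h_eq_sum hk, h_eq_sum hk]
    refine div_lt_div_of_pos_right (Finset.sum_lt_sum_of_nonempty ?_ fun i _ => ?_) hk0
    · exact Finset.nonempty_range_iff.mpr (by omega)
    · exact pow_lt_pow_left₀ hxy hx.1 (by omega)
  have hcont : Continuous (h k) := by rw [he]; fun_prop
  refine ⟨fun x hx => ⟨?_, ?_⟩, hmono.injOn, ?_⟩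
  · rw [← h0]; exact hmono.monotoneOn (by simp) hx hx.1
  · rw [← h1]; exact hmono.monotoneOn hx (by simp) hx.2
  · have := intermediate_value_Icc (zero_le_one' ℝ) hcont.continuousOn
    rwa [h0, h1] at this

end PingPong

end

noncomputable section

namespace PingPong

/-! Averaging over uniformly random Clifford gates replaces the noise `M j` by a depolarizing
channel (`twirl_eq`): the averaged bilinear form is Clifford invariant, hence diagonal in the Pauli
basis with equal entries on `X`, `Y`, `Z`. Its parameter is `l = 2μ - 1` in every round, because the
average fidelity of a channel equals `(1 + l) / 2` (`avgFidelity_comp`). The noise of rounds `2, …,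
κ` is twirled by the preceding gates, that of round 1 is averaged by the six Pauli states, and the
last gate cancels in the trace. So an execution of depth `κ` is won with probability `(1 + l ^ κ) /
2`.

By convexity of powers, the average of this over `κ` is at least `h k μ` (`h_le_avg`). Since `h k`
grows from `x = hInv k t` with slope at least `h k x = t > 5/6` (`mul_h_le_h_sub_h`), the winning
probability exceeds `t` by at least `5ε/6`. Hoeffding's inequality then bounds the failure
probability by `exp (-2n(5ε/6)²)`, which is at most `exp (-nε²)`. -/

/-! ### Unitary channels and the Clifford group -/

lemma QubitChannel.comp_apply (Λ Λ' : QubitChannel) (A : Op) : (Λ.comp Λ') A = Λ (Λ' A) := rfl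

lemma QubitChannel.ofUnitary_apply (U : Matrix.unitaryGroup (Fin 2) ℂ) (A : Op) :
    (QubitChannel.ofUnitary U) A = (U : Op) * A * (U : Op)ᴴ := rfl

lemma QubitChannel.ext {Λ Λ' : QubitChannel} (h : ∀ A, Λ A = Λ' A) : Λ = Λ' := by
  have hl : Λ.toLin = Λ'.toLin := LinearMap.ext h
  cases Λ
  cases Λ'
  cases hl
  rfl

lemma QubitChannel.ofUnitary_mul (U V : Matrix.unitaryGroup (Fin 2) ℂ) :
    QubitChannel.ofUnitary (U * V) = (QubitChannel.ofUnitary U).comp (QubitChannel.ofUnitary V) :=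
  QubitChannel.ext fun A => by
    simp [QubitChannel.comp_apply, QubitChannel.ofUnitary_apply, Matrix.conjTranspose_mul, mul_assoc]

lemma QubitChannel.ofUnitary_surjective (U : Matrix.unitaryGroup (Fin 2) ℂ) :
    Function.Surjective (QubitChannel.ofUnitary U) := fun A =>
  ⟨(QubitChannel.ofUnitary U⁻¹) A, by
    rw [← QubitChannel.comp_apply, ← QubitChannel.ofUnitary_mul, mul_inv_cancel]
    simp [QubitChannel.ofUnitary_apply]⟩

lemma QubitChannel.ofUnitary_apply_one (U : Matrix.unitaryGroup (Fin 2) ℂ) :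
    (QubitChannel.ofUnitary U) (1 : Op) = 1 := by
  have hU : (U : Op) * (U : Op)ᴴ = 1 := Matrix.mem_unitaryGroup_iff.mp U.2
  rw [QubitChannel.ofUnitary_apply, mul_one, hU]

lemma QubitChannel.trace_ofUnitary_mul (U : Matrix.unitaryGroup (Fin 2) ℂ) (A B : Op) :
    ((QubitChannel.ofUnitary U) A * (QubitChannel.ofUnitary U) B).trace = (A * B).trace := by
  have hU : (U : Op)ᴴ * (U : Op) = 1 := Matrix.mem_unitaryGroup_iff'.mp U.2
  have h : (QubitChannel.ofUnitary U) A * (QubitChannel.ofUnitary U) B =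
      (QubitChannel.ofUnitary U) (A * B) := by
    simp only [QubitChannel.ofUnitary_apply]
    calc (U : Op) * A * (U : Op)ᴴ * (↑U * B * (U : Op)ᴴ)
        = ↑U * A * ((U : Op)ᴴ * ↑U) * B * (U : Op)ᴴ := by simp only [mul_assoc]
      _ = ↑U * (A * B) * (U : Op)ᴴ := by rw [hU, mul_one, mul_assoc (U : Op)]
  rw [h, QubitChannel.trace_preserving]

lemma cliffordGates_comp {C D : QubitChannel} (hC : C ∈ cliffordGates) (hD : D ∈ cliffordGates) :
    C.comp D ∈ cliffordGates := by
  obtain ⟨U, rfl, hU⟩ := hC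
  obtain ⟨V, rfl, hV⟩ := hD
  refine ⟨U * V, (QubitChannel.ofUnitary_mul U V).symm, fun a => ?_⟩
  have hmul : ((U * V : Matrix.unitaryGroup (Fin 2) ℂ) : Op) * pauli a *
      ((U * V : Matrix.unitaryGroup (Fin 2) ℂ) : Op)ᴴ =
      (U : Op) * ((V : Op) * pauli a * (V : Op)ᴴ) * (U : Op)ᴴ := by
    simp [Matrix.conjTranspose_mul, mul_assoc]
  rw [hmul]
  obtain ⟨b, hb⟩ := hV a
  obtain ⟨d, hd⟩ := hU b
  refine ⟨d, ?_⟩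
  rcases hb with hb | hb <;> rcases hd with hd | hd <;> simp [hb, hd]

/-- Precomposition with a Clifford gate permutes the Clifford gates. -/
lemma sum_cliffordGates_comp (D : cliffordGates) {R : Type*} [AddCommMonoid R]
    (f : QubitChannel → R) :
    ∑ C : cliffordGates, f ((C : QubitChannel).comp D) = ∑ C : cliffordGates, f C := by
  let g : cliffordGates → cliffordGates := fun C => ⟨_, cliffordGates_comp C.2 D.2⟩
  have hg : Function.Injective g := by
    intro C C' h
    obtain ⟨U, hU, -⟩ := D.2
    refine Subtype.ext (QubitChannel.ext fun A => ?_)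
    obtain ⟨B, rfl⟩ := QubitChannel.ofUnitary_surjective U A
    rw [← hU, ← QubitChannel.comp_apply, ← QubitChannel.comp_apply]
    exact congrArg (fun Λ : QubitChannel => Λ B) (congrArg Subtype.val h)
  exact Fintype.sum_bijective g ((Finite.injective_iff_bijective).mp hg) _ _ fun _ => rfl

/-! ### Three Clifford gates and their action on the Pauli matrices -/

/-- The Pauli gate `X`. -/
def gateX : Matrix.unitaryGroup (Fin 2) ℂ :=
  ⟨pauli 0, Matrix.mem_unitaryGroup_iff.mpr (by
    ext i j
    fin_cases i <;> fin_cases j <;>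
      simp [pauli, Matrix.star_eq_conjTranspose, Matrix.mul_apply])⟩

/-- The Pauli gate `Z`. -/
def gateZ : Matrix.unitaryGroup (Fin 2) ℂ :=
  ⟨pauli 2, Matrix.mem_unitaryGroup_iff.mpr (by
    ext i j
    fin_cases i <;> fin_cases j <;>
      simp [pauli, Matrix.star_eq_conjTranspose, Matrix.mul_apply])⟩

/-- The Clifford gate `(1 - i (X + Y + Z)) / 2`, which permutes the Pauli matrices cyclically. -/
def gateCyc : Matrix.unitaryGroup (Fin 2) ℂ :=
  ⟨!![(1 - Complex.I) / 2, (-1 - Complex.I) / 2; (1 - Complex.I) / 2, (1 + Complex.I) / 2],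
    Matrix.mem_unitaryGroup_iff.mpr (by
      have hI : Complex.I * Complex.I = -1 := Complex.I_mul_I
      have h2 : (starRingEnd ℂ) 2 = 2 := Complex.conj_ofNat 2
      ext i j
      fin_cases i <;> fin_cases j <;>
        simp [Matrix.star_eq_conjTranspose, Matrix.mul_apply, -Matrix.cons_mul, h2] <;>
        grind)⟩

lemma gateX_pauli (a : Fin 3) : (QubitChannel.ofUnitary gateX) (pauli a) =
    (![1, -1, -1] a : ℂ) • pauli a := by
  rw [QubitChannel.ofUnitary_apply]
  ext i j
  fin_cases a <;> fin_cases i <;> fin_cases j <;>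
    simp [gateX, pauli, Matrix.mul_apply, -Matrix.cons_mul]

lemma gateZ_pauli (a : Fin 3) : (QubitChannel.ofUnitary gateZ) (pauli a) =
    (![-1, -1, 1] a : ℂ) • pauli a := by
  rw [QubitChannel.ofUnitary_apply]
  ext i j
  fin_cases a <;> fin_cases i <;> fin_cases j <;>
    simp [gateZ, pauli, Matrix.mul_apply, -Matrix.cons_mul]

lemma gateCyc_pauli (a : Fin 3) : (QubitChannel.ofUnitary gateCyc) (pauli a) = pauli (a + 1) := by
  have hI : Complex.I * Complex.I = -1 := Complex.I_mul_I
  have h2 : (starRingEnd ℂ) 2 = 2 := Complex.conj_ofNat 2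
  rw [QubitChannel.ofUnitary_apply]
  ext i j
  fin_cases a <;> fin_cases i <;> fin_cases j <;>
    simp [gateCyc, pauli, Matrix.mul_apply, -Matrix.cons_mul, h2] <;> grind

lemma gateX_mem : QubitChannel.ofUnitary gateX ∈ cliffordGates := by
  refine ⟨_, rfl, fun a => ⟨a, ?_⟩⟩
  rw [← QubitChannel.ofUnitary_apply, gateX_pauli]
  fin_cases a <;> simp

lemma gateZ_mem : QubitChannel.ofUnitary gateZ ∈ cliffordGates := by
  refine ⟨_, rfl, fun a => ⟨a, ?_⟩⟩
  rw [← QubitChannel.ofUnitary_apply, gateZ_pauli]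
  fin_cases a <;> simp

lemma gateCyc_mem : QubitChannel.ofUnitary gateCyc ∈ cliffordGates :=
  ⟨_, rfl, fun a => ⟨a + 1, Or.inl (gateCyc_pauli a)⟩⟩

lemma trace_pauli (a : Fin 3) : (pauli a).trace = 0 := by
  fin_cases a <;> simp [pauli, Matrix.trace_fin_two]

lemma pauli_injective : Function.Injective pauli := by
  intro a b h
  have h0 := congrFun (congrFun h 0) 0
  have h1 := congrFun (congrFun h 0) 1
  have hI := Complex.I_ne_zero
  have hI1 : (1 : ℂ) ≠ -Complex.I := by simp [Complex.ext_iff]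
  have hI2 : -Complex.I ≠ (1 : ℂ) := by simp [Complex.ext_iff]
  fin_cases a <;> fin_cases b <;> simp_all [pauli]

lemma pauli_ne_neg (a b : Fin 3) : pauli a ≠ -pauli b := by
  intro h
  have h0 := congrFun (congrFun h 0) 0
  have h1 := congrFun (congrFun h 0) 1
  have h2 := congrFun (congrFun h 1) 0
  have hI := Complex.I_ne_zero
  fin_cases a <;> fin_cases b <;> simp [pauli, Complex.ext_iff] at h0 h1 h2 <;> norm_num at *

/-! ### The Clifford twirl -/

/-- The bilinear form `(X, Y) ↦ Tr[Λ'(X) Λ(Y)]`. -/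
def overlap (Λ' Λ : QubitChannel) : Op →ₗ[ℂ] Op →ₗ[ℂ] ℂ :=
  ((LinearMap.mul ℂ Op).compr₂ (Matrix.traceLinearMap (Fin 2) ℂ ℂ)).compl₁₂ Λ'.toLin Λ.toLin

@[simp] lemma overlap_apply (Λ' Λ : QubitChannel) (X Y : Op) :
    overlap Λ' Λ X Y = (Λ' X * Λ Y).trace := rfl

/-- The sum over the Clifford gates `C` of the bilinear forms `(X, Y) ↦ Tr[M(C(X)) C(Y)]`. -/
def twirl (M : QubitChannel) : Op →ₗ[ℂ] Op →ₗ[ℂ] ℂ :=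
  ∑ C : cliffordGates, overlap (M.comp C) C

lemma twirl_apply (M : QubitChannel) (X Y : Op) :
    twirl M X Y = ∑ C : cliffordGates, (M ((C : QubitChannel) X) * (C : QubitChannel) Y).trace := by
  simp [twirl, LinearMap.sum_apply, QubitChannel.comp_apply]

lemma twirl_invariant (M : QubitChannel) (D : cliffordGates) (X Y : Op) :
    twirl M ((D : QubitChannel) X) ((D : QubitChannel) Y) = twirl M X Y := by
  rw [twirl_apply, twirl_apply]
  exact sum_cliffordGates_comp D fun C => (M (C X) * C Y).trace

lemma cliffordGates_apply_one (C : cliffordGates) : (C : QubitChannel) (1 : Op) = 1 := by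
  obtain ⟨_, U, rfl, -⟩ := C
  exact QubitChannel.ofUnitary_apply_one U

lemma trace_cliffordGates_mul (C : cliffordGates) (A B : Op) :
    ((C : QubitChannel) A * (C : QubitChannel) B).trace = (A * B).trace := by
  obtain ⟨_, U, rfl, -⟩ := C
  exact QubitChannel.trace_ofUnitary_mul U A B

lemma twirl_apply_one (M : QubitChannel) (X : Op) :
    twirl M X 1 = Fintype.card cliffordGates * X.trace := by
  simp [twirl_apply, cliffordGates_apply_one, QubitChannel.trace_preserving]

/-- Each Pauli matrix changes sign under conjugation by `X` or by `Z`, while `1` is fixed, so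
invariance forces the value to equal its negative. -/
lemma twirl_one_pauli (M : QubitChannel) (a : Fin 3) : twirl M 1 (pauli a) = 0 := by
  have hX := twirl_invariant M ⟨_, gateX_mem⟩ 1 (pauli a)
  have hZ := twirl_invariant M ⟨_, gateZ_mem⟩ 1 (pauli a)
  simp only [QubitChannel.ofUnitary_apply_one, gateX_pauli, gateZ_pauli, map_smul,
    smul_eq_mul] at hX hZ
  fin_cases a <;> simp at hX hZ ⊢ <;> grind

/-- Two distinct Pauli matrices are told apart by their signs under conjugation by `X` or by `Z`;
the gate that flips exactly one of them kills the entry. -/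
lemma twirl_pauli_of_ne (M : QubitChannel) {a b : Fin 3} (hab : a ≠ b) :
    twirl M (pauli a) (pauli b) = 0 := by
  have hX := twirl_invariant M ⟨_, gateX_mem⟩ (pauli a) (pauli b)
  have hZ := twirl_invariant M ⟨_, gateZ_mem⟩ (pauli a) (pauli b)
  simp only [gateX_pauli, gateZ_pauli, map_smul, LinearMap.smul_apply, smul_eq_mul] at hX hZ
  fin_cases a <;> fin_cases b <;> simp at hab hX hZ ⊢ <;> grind

/-- `∑ₐ Tr[M(σₐ) σₐ] / 6`, the parameter of the depolarizing channel obtained by twirling `M`. -/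
def depolParam (M : QubitChannel) : ℂ := (∑ a, (M (pauli a) * pauli a).trace) / 6

/-- A Clifford gate acts on the Pauli matrices as a signed permutation, and each sign occurs twice
in its summand. -/
lemma sum_cliffordGates_pauli (M : QubitChannel) (C : cliffordGates) :
    ∑ a, (M ((C : QubitChannel) (pauli a)) * (C : QubitChannel) (pauli a)).trace =
      ∑ a, (M (pauli a) * pauli a).trace := by
  obtain ⟨_, U, rfl, hU⟩ := C
  have hU' := hU
  choose b hb using hU'
  simp only [← QubitChannel.ofUnitary_apply] at hb
  have hinj : Function.Injective (QubitChannel.ofUnitary U) := by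
    have h := QubitChannel.ofUnitary_surjective U
    exact (LinearMap.injective_iff_surjective (f := (QubitChannel.ofUnitary U).toLin)).mpr h
  have hbi : Function.Injective b := by
    intro a a' h
    have hcases : (QubitChannel.ofUnitary U) (pauli a) = (QubitChannel.ofUnitary U) (pauli a') ∨
        (QubitChannel.ofUnitary U) (pauli a) = (QubitChannel.ofUnitary U) (-pauli a') := by
      rw [map_neg]
      rcases hb a with h1 | h1 <;> rcases hb a' with h2 | h2 <;> simp [h1, h2, h]
    rcases hcases with h1 | h1
    · exact pauli_injective (hinj h1)
    · exact absurd (hinj h1) (pauli_ne_neg _ _)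
  refine Fintype.sum_bijective b (Finite.injective_iff_bijective.mp hbi) _ _ fun a => ?_
  rcases hb a with h | h <;> simp [h]

/-- The cyclic gate makes the three diagonal entries equal, so each is a third of their sum, to
which every Clifford gate contributes equally. -/
lemma twirl_pauli_self (M : QubitChannel) (a : Fin 3) :
    twirl M (pauli a) (pauli a) = Fintype.card cliffordGates * (2 * depolParam M) := by
  have hcyc : ∀ a, twirl M (pauli (a + 1)) (pauli (a + 1)) = twirl M (pauli a) (pauli a) := by
    intro a
    simpa only [gateCyc_pauli] using twirl_invariant M ⟨_, gateCyc_mem⟩ (pauli a) (pauli a)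
  have hsum : ∑ a, twirl M (pauli a) (pauli a) =
      Fintype.card cliffordGates * (6 * depolParam M) := by
    simp only [twirl_apply]
    rw [Finset.sum_comm]
    simp only [sum_cliffordGates_pauli, depolParam]
    rw [Finset.sum_const, Finset.card_univ, nsmul_eq_mul]
    ring
  have h0 := hcyc 0
  have h1 := hcyc 1
  rw [Fin.sum_univ_three] at hsum
  simp only [zero_add, show (1 + 1 : Fin 3) = 2 from rfl] at h0 h1
  obtain rfl | rfl | rfl : a = 0 ∨ a = 1 ∨ a = 2 := by fin_cases a <;> simp
  · linear_combination hsum / 3 - h1 / 3 - 2 * h0 / 3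
  · linear_combination hsum / 3 - h1 / 3 + h0 / 3
  · linear_combination hsum / 3 + 2 * h1 / 3 + h0 / 3

/-- Twirling a channel over the Clifford gates gives a depolarizing channel. -/
lemma twirl_eq (M : QubitChannel) (X Y : Op) :
    twirl M X Y = Fintype.card cliffordGates *
      (depolParam M * (X * Y).trace + (1 - depolParam M) / 2 * (X.trace * Y.trace)) := by
  have h1 : twirl M 1 1 = Fintype.card cliffordGates * 2 := by simp [twirl_apply_one]
  have ha : ∀ a, twirl M (pauli a) 1 = 0 := fun a => by simp [twirl_apply_one, trace_pauli]
  have hI : Complex.I * Complex.I = -1 := Complex.I_mul_I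
  conv_lhs => rw [op_eq_pauli X, op_eq_pauli Y]
  simp only [map_add, map_smul, LinearMap.add_apply, LinearMap.smul_apply, smul_eq_mul, h1, ha,
    twirl_one_pauli, twirl_pauli_self, twirl_pauli_of_ne M (show (0 : Fin 3) ≠ 1 by decide),
    twirl_pauli_of_ne M (show (0 : Fin 3) ≠ 2 by decide),
    twirl_pauli_of_ne M (show (1 : Fin 3) ≠ 0 by decide),
    twirl_pauli_of_ne M (show (1 : Fin 3) ≠ 2 by decide),
    twirl_pauli_of_ne M (show (2 : Fin 3) ≠ 0 by decide),
    twirl_pauli_of_ne M (show (2 : Fin 3) ≠ 1 by decide), mul_zero, add_zero, zero_add]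
  simp only [Matrix.trace_fin_two, Matrix.mul_apply, Fin.sum_univ_two]
  linear_combination (Fintype.card cliffordGates : ℂ) * depolParam M / 2 *
    ((X 0 1 - X 1 0) * (Y 0 1 - Y 1 0)) * hI

/-! ### Averaging over the six Pauli eigenstates -/

lemma ketbra_pauliState (s : Fin 6) : ketbra (pauliState s) =
    ![(1 / 2 : ℂ) • (1 + pauli 2), (1 / 2 : ℂ) • (1 - pauli 2), (1 / 2 : ℂ) • (1 + pauli 0),
      (1 / 2 : ℂ) • (1 - pauli 0), (1 / 2 : ℂ) • (1 + pauli 1), (1 / 2 : ℂ) • (1 - pauli 1)] s := by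
  have h2 : ((√2 : ℝ) : ℂ)⁻¹ * ((√2 : ℝ) : ℂ)⁻¹ = 2⁻¹ := by
    rw [← mul_inv, ← Complex.ofReal_mul, Real.mul_self_sqrt (by norm_num)]; norm_num
  have hI : Complex.I * Complex.I = -1 := Complex.I_mul_I
  ext i j
  fin_cases s <;> fin_cases i <;> fin_cases j <;>
    simp [ketbra, pauliState, pauliKet, pauli, Matrix.vecMulVec_apply] <;> grind

/-- In each antipodal pair `(1 ± σ) / 2` the cross terms cancel, leaving `Tr[M(1)]` and `Tr[M(σ)
σ]`. This stands in for the twirl in round 1, which no gate precedes. -/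
lemma sum_pauliState (M : QubitChannel) :
    ∑ s, (M (ketbra (pauliState s)) * ketbra (pauliState s)).trace =
      6 * ((1 + depolParam M) / 2) := by
  have h1 : (M (1 : Op)).trace = 2 := by simp [M.trace_preserving]
  simp only [Fin.sum_univ_six, ketbra_pauliState, depolParam, Fin.sum_univ_three]
  simp [mul_add, add_mul, mul_sub, sub_mul, M.trace_preserving, trace_pauli]
  ring

/-- The sum over the Pauli states is a sum of traces of products of positive operators, hence real.
-/
lemma depolParam_im (M : QubitChannel) : (depolParam M).im = 0 := by
  have h : 0 ≤ ∑ s, (M (ketbra (pauliState s)) * ketbra (pauliState s)).trace :=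
    Finset.sum_nonneg fun s _ =>
      trace_mul_nonneg (M.posSemidef (posSemidef_ketbra _)) (posSemidef_ketbra _)
  rw [sum_pauliState] at h
  have := (Complex.nonneg_iff.mp h).2
  simpa using this.symm

/-! ### Unitary invariance of the Haar measure and the average fidelity -/

open MeasureTheory Pointwise in
/-- Linear isometries preserve the surface measure of the unit sphere. -/
lemma measurePreserving_toSphere {E : Type*} [NormedAddCommGroup E] [InnerProductSpace ℝ E]
    [FiniteDimensional ℝ E] [MeasurableSpace E] [BorelSpace E] (e : E ≃ₗᵢ[ℝ] E)
    {f : Metric.sphere (0 : E) 1 → Metric.sphere (0 : E) 1} (hf : ∀ x, (f x : E) = e x) :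
    MeasurePreserving f (volume : Measure E).toSphere (volume : Measure E).toSphere := by
  have hfc : Continuous f := by
    refine Continuous.subtype_mk (f := fun x : Metric.sphere (0 : E) 1 => (f x : E)) ?_ _
    simp only [hf]
    exact e.continuous.comp continuous_subtype_val
  refine ⟨hfc.measurable, Measure.ext fun s hs => ?_⟩
  -- The surface measure of a set is a fixed multiple of the volume of the cone over it, and `e`
  -- preserves volume and commutes with forming cones.
  rw [Measure.map_apply hfc.measurable hs, Measure.toSphere_apply' _ hs,
    Measure.toSphere_apply' _ (hfc.measurable hs),
    ← (e.measurePreserving).measure_preimage_emb e.toHomeomorph.measurableEmbedding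
      (Set.Ioo (0 : ℝ) 1 • (Subtype.val '' s))]
  congr 2
  ext x
  simp only [Set.mem_preimage, Set.mem_smul, Set.mem_image]
  constructor
  · rintro ⟨r, hr, _, ⟨y, hy, rfl⟩, rfl⟩
    exact ⟨r, hr, _, ⟨f y, hy, rfl⟩, by rw [hf, map_smul]⟩
  · rintro ⟨r, hr, _, ⟨y, hy, rfl⟩, hx⟩
    refine ⟨r, hr, e.symm y, ⟨⟨e.symm y, by simp⟩, ?_, rfl⟩, ?_⟩
    · have : f ⟨e.symm y, by simp⟩ = y := Subtype.ext (by simp [hf])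
      rwa [this]
    · rw [← map_smul, hx, e.symm_apply_apply]

lemma norm_toEuclideanLin_unitary (U : Matrix.unitaryGroup (Fin 2) ℂ) (x : Qubit) :
    ‖Matrix.toEuclideanLin (U : Op) x‖ = ‖x‖ := by
  have hU : (U : Op)ᴴ * (U : Op) = 1 := Matrix.mem_unitaryGroup_iff'.mp U.2
  have hx : (Matrix.toEuclideanLin (U : Op) x).ofLp = (U : Op) *ᵥ x.ofLp := rfl
  have h : inner ℂ (Matrix.toEuclideanLin (U : Op) x) (Matrix.toEuclideanLin (U : Op) x) =
      inner ℂ x x := by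
    rw [EuclideanSpace.inner_eq_star_dotProduct, EuclideanSpace.inner_eq_star_dotProduct,
      hx, Matrix.star_mulVec, dotProduct_comm,
      ← Matrix.dotProduct_mulVec, Matrix.mulVec_mulVec, hU, Matrix.one_mulVec, dotProduct_comm]
  rw [inner_self_eq_norm_sq_to_K, inner_self_eq_norm_sq_to_K] at h
  exact (sq_eq_sq₀ (norm_nonneg _) (norm_nonneg _)).mp (by exact_mod_cast h)

/-- The action of a unitary on the qubit, as a real linear isometry. -/
def unitaryIsometry (U : Matrix.unitaryGroup (Fin 2) ℂ) : Qubit ≃ₗᵢ[ℝ] Qubit :=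
  LinearIsometry.toLinearIsometryEquiv
    { (Matrix.toEuclideanLin (U : Op)).restrictScalars ℝ with
      norm_map' := norm_toEuclideanLin_unitary U } rfl

lemma ofLp_unitaryIsometry (U : Matrix.unitaryGroup (Fin 2) ℂ) (x : Qubit) :
    (unitaryIsometry U x).ofLp = (U : Op) *ᵥ x.ofLp := rfl

/-- The action of a unitary on pure states. -/
def unitaryState (U : Matrix.unitaryGroup (Fin 2) ℂ) (ψ : PureState) : PureState :=
  ⟨unitaryIsometry U ψ, by simp⟩

lemma ketbra_unitaryState (U : Matrix.unitaryGroup (Fin 2) ℂ) (ψ : PureState) :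
    ketbra (unitaryState U ψ) = (QubitChannel.ofUnitary U) (ketbra ψ) := by
  rw [QubitChannel.ofUnitary_apply, ketbra, ketbra, unitaryState, ofLp_unitaryIsometry,
    Matrix.star_mulVec, Matrix.mul_vecMulVec, Matrix.vecMulVec_mul]

lemma continuous_ketbra : Continuous ketbra := by
  unfold ketbra Matrix.vecMulVec
  fun_prop

lemma continuous_overlap_ketbra (Λ' Λ : QubitChannel) :
    Continuous fun ψ : PureState => (Λ' (ketbra ψ) * Λ (ketbra ψ)).trace.re := by
  have h : ∀ Λ : QubitChannel, Continuous fun ψ : PureState => Λ (ketbra ψ) := fun Λ =>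
    Λ.toLin.continuous_of_finiteDimensional.comp continuous_ketbra
  exact Complex.continuous_re.comp ((h Λ').mul (h Λ)).matrix_trace

lemma trace_ketbra_mul_self (ψ : PureState) : (ketbra ψ * ketbra ψ).trace = 1 := by
  have h := trace_ketbra ψ
  simp only [ketbra, Matrix.trace_fin_two, Matrix.mul_apply, Matrix.vecMulVec_apply,
    Fin.sum_univ_two] at h ⊢
  linear_combination ((ψ : Qubit).ofLp 0 * star (ψ : Qubit).ofLp 0 +
    (ψ : Qubit).ofLp 1 * star (ψ : Qubit).ofLp 1 + 1) * h

open MeasureTheory in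
/-- The average fidelity of a channel is determined by its depolarizing parameter. -/
lemma avgFidelity_comp (M : QubitChannel) {C : QubitChannel} (hC : C ∈ cliffordGates) :
    avgFidelity (C.comp M) C = ((1 + depolParam M) / 2).re := by
  let ν : Measure PureState := (volume : Measure Qubit).toSphere
  let F : PureState → ℝ := fun ψ => (M (ketbra ψ) * ketbra ψ).trace.re
  have hF : Continuous F := continuous_overlap_ketbra M QubitChannel.id
  -- Unitary invariance allows inserting any Clifford gate before `M`. Summed over the gates, the
  -- integrand becomes the twirl, which is constant in `ψ`, so no Haar integral has to be computed.
  have hinv : ∀ D : cliffordGates, ∫ ψ, ((M.comp D) (ketbra ψ) *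
      (D : QubitChannel) (ketbra ψ)).trace.re ∂ν = ∫ ψ, F ψ ∂ν := by
    rintro ⟨_, U, rfl, -⟩
    have hmp : MeasurePreserving (unitaryState U) ν ν :=
      measurePreserving_toSphere (unitaryIsometry U) fun _ => rfl
    conv_rhs => rw [← hmp.map_eq]
    rw [integral_map hmp.measurable.aemeasurable hF.aestronglyMeasurable]
    simp only [F, ketbra_unitaryState]
    rfl
  have hsum : ∑ D : cliffordGates, ∫ ψ, ((M.comp D) (ketbra ψ) *
      (D : QubitChannel) (ketbra ψ)).trace.re ∂ν =
      Fintype.card cliffordGates * (((1 + depolParam M) / 2).re * ν.real Set.univ) := by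
    rw [← integral_finsetSum _ fun D _ =>
      (continuous_overlap_ketbra _ _).integrable_of_hasCompactSupport
        (HasCompactSupport.of_compactSpace _)]
    have hc : ∀ ψ : PureState, ∑ D : cliffordGates, ((M.comp D) (ketbra ψ) *
        (D : QubitChannel) (ketbra ψ)).trace.re =
        Fintype.card cliffordGates * ((1 + depolParam M) / 2).re := by
      intro ψ
      rw [← Complex.re_sum]
      have h := twirl_eq M (ketbra ψ) (ketbra ψ)
      rw [twirl_apply, trace_ketbra_mul_self, trace_ketbra] at h
      refine (congrArg Complex.re h).trans ?_
      rw [← Complex.re_ofReal_mul, Complex.ofReal_natCast]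
      congr 2
      ring
    simp only [hc, integral_const, smul_eq_mul]
    ring
  have hN : (Fintype.card cliffordGates : ℝ) ≠ 0 := by
    exact_mod_cast Fintype.card_ne_zero
  simp only [hinv, Finset.sum_const, Finset.card_univ, nsmul_eq_mul] at hsum
  have hint := mul_left_cancel₀ hN hsum
  have hν : ν.real Set.univ ≠ 0 := by
    have h0 : ν ≠ 0 := Measure.toSphere_ne_zero _
    rw [Measure.real, ENNReal.toReal_ne_zero]
    exact ⟨by simpa using h0, measure_ne_top _ _⟩
  have hfid : avgFidelity (C.comp M) C = ⨍ ψ, F ψ ∂ν := by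
    unfold avgFidelity
    congr 1
    funext ψ
    exact congrArg Complex.re (trace_cliffordGates_mul ⟨C, hC⟩ _ _)
  rw [hfid, average_eq, hint, smul_eq_mul]
  field_simp

lemma depolParam_eq {M C : QubitChannel} (hC : C ∈ cliffordGates) {μ : ℝ}
    (h : avgFidelity (C.comp M) C = μ) : depolParam M = ((2 * μ - 1 : ℝ) : ℂ) := by
  rw [avgFidelity_comp M hC] at h
  refine Complex.ext ?_ (by rw [depolParam_im, Complex.ofReal_im])
  rw [Complex.ofReal_re]
  simp at h
  linarith

/-! ### Acceptance probability at a fixed depth -/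

lemma testChannel_snoc (M : ℕ → QubitChannel) {κ : ℕ} (c : Fin κ → cliffordGates)
    (C : cliffordGates) (A : Op) :
    (testChannel M (Fin.snoc (α := fun _ => cliffordGates) c C : Fin (κ + 1) → cliffordGates)) A =
      (C : QubitChannel) ((M (κ + 1)) ((testChannel M c) A)) := by
  simp [testChannel, compRounds, QubitChannel.comp_apply]

lemma idealChannel_snoc {κ : ℕ} (c : Fin κ → cliffordGates) (C : cliffordGates) (A : Op) :
    (idealChannel (Fin.snoc (α := fun _ => cliffordGates) c C : Fin (κ + 1) → cliffordGates)) A =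
      (C : QubitChannel) ((idealChannel c) A) := by
  simp [idealChannel, compRounds, QubitChannel.comp_apply]

lemma sum_fin_succ_pi {α R : Type*} [Fintype α] [AddCommMonoid R] {κ : ℕ}
    (f : (Fin (κ + 1) → α) → R) :
    ∑ c, f c = ∑ c : Fin κ → α, ∑ a, f (Fin.snoc (α := fun _ => α) c a) := by
  rw [← (Fin.snocEquiv fun _ : Fin (κ + 1) => α).sum_comp f, Fintype.sum_prod_type,
    Finset.sum_comm]
  rfl

/-- Ending with the noise of round `κ + 1`, before its gate, is what makes the induction close: the
gate of round `κ` is then summed around that noise, which is exactly a twirl. `M 1` is never twirled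
and remains in the formula. -/
lemma sum_trace_testChannel_aux (M : ℕ → QubitChannel) (l : ℂ) (κ : ℕ)
    (hM : ∀ j ∈ Finset.Icc 1 (κ + 1), depolParam (M j) = l) {A B : Op} (hA : A.trace = 1)
    (hB : B.trace = 1) :
    ∑ c : Fin κ → cliffordGates, ((M (κ + 1)) ((testChannel M c) A) * (idealChannel c) B).trace =
      (Fintype.card cliffordGates) ^ κ * (l ^ κ * (M 1 A * B).trace + (1 - l ^ κ) / 2) := by
  induction κ with
  | zero => simp [testChannel, idealChannel, compRounds, QubitChannel.id]
  | succ κ ih =>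
    have ih := ih fun j hj => hM j (by simp at hj ⊢; omega)
    have hl : depolParam (M (κ + 1 + 1)) = l := hM _ (by simp)
    rw [sum_fin_succ_pi]
    simp only [testChannel_snoc, idealChannel_snoc]
    simp only [← twirl_apply, twirl_eq, hl, QubitChannel.trace_preserving, hA, hB]
    rw [← Finset.mul_sum, Finset.sum_add_distrib, ← Finset.mul_sum, ih]
    simp only [Finset.sum_const, Finset.card_univ, Fintype.card_fun, Fintype.card_fin,
      nsmul_eq_mul, Nat.cast_pow]
    ring

/-- The sum over all gate sequences of depth `κ` of the acceptance probabilities. -/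
lemma sum_trace_testChannel (M : ℕ → QubitChannel) (l : ℂ) (κ : ℕ)
    (hM : ∀ j ∈ Finset.Icc 1 (κ + 1), depolParam (M j) = l) {A B : Op} (hA : A.trace = 1)
    (hB : B.trace = 1) :
    ∑ c : Fin (κ + 1) → cliffordGates, ((testChannel M c) A * (idealChannel c) B).trace =
      (Fintype.card cliffordGates) ^ (κ + 1) *
        (l ^ κ * (M 1 A * B).trace + (1 - l ^ κ) / 2) := by
  rw [sum_fin_succ_pi]
  -- The final gate is applied to both factors and drops out of the trace, so summing over it only
  -- gives a factor.
  simp only [testChannel_snoc, idealChannel_snoc, trace_cliffordGates_mul, Finset.sum_const,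
    Finset.card_univ, nsmul_eq_mul]
  rw [← Finset.mul_sum, sum_trace_testChannel_aux M l κ hM hA hB]
  ring

lemma sum_trace_testChannel_pauliState (M : ℕ → QubitChannel) (l : ℂ) (κ : ℕ)
    (hM : ∀ j ∈ Finset.Icc 1 (κ + 1), depolParam (M j) = l) :
    ∑ c : Fin (κ + 1) → cliffordGates, ∑ s, ((testChannel M c) (ketbra (pauliState s)) *
        (idealChannel c) (ketbra (pauliState s))).trace =
      (Fintype.card cliffordGates) ^ (κ + 1) * (6 * ((1 + l ^ (κ + 1)) / 2)) := by
  rw [Finset.sum_comm]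
  simp only [sum_trace_testChannel M l κ hM (trace_ketbra _) (trace_ketbra _)]
  rw [← Finset.mul_sum, Finset.sum_add_distrib, ← Finset.mul_sum, sum_pauliState,
    hM 1 (by simp)]
  simp only [Finset.sum_const, Finset.card_univ, Fintype.card_fin, nsmul_eq_mul]
  push_cast
  ring

/-! ### Acceptance probability of one execution -/

lemma toReal_bind_uniformOfFinset {α β : Type*} (s : Finset α) (hs : s.Nonempty)
    (f : α → PMF β) (b : β) :
    ((PMF.uniformOfFinset s hs).bind f b).toReal = (∑ a ∈ s, (f a b).toReal) / s.card := by
  classical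
  rw [PMF.bind_apply, tsum_eq_sum (s := s) fun a ha => by
    rw [PMF.uniformOfFinset_apply_of_notMem hs ha, zero_mul],
    ENNReal.toReal_sum fun a _ => ENNReal.mul_ne_top (PMF.apply_ne_top _ _) (PMF.apply_ne_top _ _),
    Finset.sum_div]
  refine Finset.sum_congr rfl fun a ha => ?_
  rw [PMF.uniformOfFinset_apply_of_mem hs ha, ENNReal.toReal_mul, ENNReal.toReal_inv,
    ENNReal.toReal_natCast]
  field_simp

lemma toReal_bind_uniformOfFintype {α β : Type*} [Fintype α] [Nonempty α] (f : α → PMF β)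
    (b : β) :
    ((PMF.uniformOfFintype α).bind f b).toReal = (∑ a, (f a b).toReal) / Fintype.card α :=
  toReal_bind_uniformOfFinset Finset.univ Finset.univ_nonempty f b

lemma toReal_verdictLaw_true (S G : QubitChannel) (ψ : PureState) :
    (verdictLaw S G ψ true).toReal = (S (ketbra ψ) * G (ketbra ψ)).trace.re := by
  rw [verdictLaw, PMF.ofFintype_apply, ENNReal.toReal_ofReal]
  · rfl
  · exact (Complex.nonneg_iff.mp (trace_mul_nonneg (S.posSemidef (posSemidef_ketbra ψ))
      (posSemidef_povm G ψ true))).1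

/-- The probability of acceptance in a single execution. -/
lemma toReal_executionLaw_true {k : ℕ} (hk : 1 ≤ k) (M : ℕ → QubitChannel) (l : ℝ)
    (hM : ∀ j ∈ Finset.Icc 1 k, depolParam (M j) = l) :
    (executionLaw k hk M true).toReal = (∑ i ∈ Finset.range k, (1 + l ^ (i + 1)) / 2) / k := by
  have hN : (Fintype.card cliffordGates : ℝ) ≠ 0 := by exact_mod_cast Fintype.card_ne_zero
  rw [executionLaw, toReal_bind_uniformOfFinset, Nat.card_Icc, Nat.add_sub_cancel]
  congr 1
  -- Shifts the index from depths `1, …, k` to `0, …, k - 1`.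
  change ∑ κ ∈ Finset.Ico (0 + 1) (k + 1), _ = _
  rw [← Finset.sum_Ico_add', ← Finset.range_eq_Ico]
  refine Finset.sum_congr rfl fun κ hκ => ?_
  have hsum := congrArg Complex.re (sum_trace_testChannel_pauliState M l κ fun j hj =>
    hM j (by simp at hj hκ ⊢; omega))
  have hre : ((Fintype.card cliffordGates : ℂ) ^ (κ + 1) * (6 * ((1 + (l : ℂ) ^ (κ + 1)) / 2))).re =
      (Fintype.card cliffordGates : ℝ) ^ (κ + 1) * (6 * ((1 + l ^ (κ + 1)) / 2)) := by
    rw [← Complex.ofReal_re ((Fintype.card cliffordGates : ℝ) ^ (κ + 1) * _)]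
    push_cast
    rfl
  rw [hre] at hsum
  simp only [Complex.re_sum] at hsum
  simp only [toReal_bind_uniformOfFintype, toReal_verdictLaw_true]
  rw [← Finset.sum_div, hsum, Fintype.card_fun, Fintype.card_fin, Fintype.card_fin]
  push_cast
  field_simp

/-! ### Estimates for `h k` -/

lemma h_le_self {k : ℕ} (hk : 1 ≤ k) {x : ℝ} (hx : x ∈ Set.Icc (0 : ℝ) 1) : h k x ≤ x := by
  have hk0 : (0 : ℝ) < k := by positivity
  rw [h_eq_sum hk, div_le_iff₀ hk0]
  calc ∑ i ∈ Finset.range k, x ^ (i + 1) ≤ ∑ i ∈ Finset.range k, x :=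
        Finset.sum_le_sum fun i _ => pow_le_of_le_one hx.1 hx.2 i.succ_ne_zero
    _ = x * k := by simp [mul_comm]

/-- Termwise, `y ^ (i + 1) - x ^ (i + 1) ≥ (y - x) * x ^ i ≥ (y - x) * x ^ (i + 1)`. -/
lemma mul_h_le_h_sub_h {k : ℕ} (hk : 1 ≤ k) {x y : ℝ} (hx : x ∈ Set.Icc (0 : ℝ) 1) (hxy : x ≤ y) :
    (y - x) * h k x ≤ h k y - h k x := by
  have hk0 : (0 : ℝ) < k := by positivity
  rw [h_eq_sum hk, h_eq_sum hk, ← sub_div, ← mul_div_assoc, Finset.mul_sum,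
    ← Finset.sum_sub_distrib]
  refine div_le_div_of_nonneg_right (Finset.sum_le_sum fun i _ => ?_) hk0.le
  have h1 : x ^ i ≤ y ^ i := pow_le_pow_left₀ hx.1 hxy i
  have h2 : x ^ (i + 1) ≤ x ^ i := pow_le_pow_of_le_one hx.1 hx.2 i.le_succ
  have h3 := mul_le_mul_of_nonneg_left h1 (hx.1.trans hxy)
  have h4 := mul_le_mul_of_nonneg_left h2 (sub_nonneg.mpr hxy)
  rw [pow_succ'] at *
  rw [pow_succ']
  linarith

/-- `μ` is the midpoint of `1` and `2 * μ - 1`, so convexity of each power applies; `1 / 2 ≤ μ`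
keeps the second point nonnegative, where odd powers are convex too. -/
lemma h_le_avg {k : ℕ} (hk : 1 ≤ k) {μ : ℝ} (hμ : 1 / 2 ≤ μ) :
    h k μ ≤ (∑ i ∈ Finset.range k, (1 + (2 * μ - 1) ^ (i + 1)) / 2) / k := by
  have hk0 : (0 : ℝ) < k := by positivity
  rw [h_eq_sum hk]
  refine div_le_div_of_nonneg_right (Finset.sum_le_sum fun i _ => ?_) hk0.le
  have hconv : ConvexOn ℝ (Set.Ici (0 : ℝ)) fun x => x ^ (i + 1) := convexOn_pow (i + 1)
  have h1 : (1 : ℝ) ∈ Set.Ici (0 : ℝ) := Set.mem_Ici.mpr zero_le_one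
  have h2 : 2 * μ - 1 ∈ Set.Ici (0 : ℝ) := Set.mem_Ici.mpr (by linarith)
  have hhalf : (0 : ℝ) ≤ 1 / 2 := by norm_num
  have hc := hconv.2 h1 h2 hhalf hhalf (by norm_num)
  simp only [smul_eq_mul, one_pow] at hc
  rw [show 1 / 2 * 1 + 1 / 2 * (2 * μ - 1) = μ by ring] at hc
  linarith

lemma hInv_mem {k : ℕ} (hk : 1 ≤ k) {t : ℝ} (ht : t ∈ Set.Icc (0 : ℝ) 1) :
    hInv k t ∈ Set.Icc (0 : ℝ) 1 := Function.invFunOn_mem ((bijOn_h hk).surjOn ht)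

lemma h_hInv {k : ℕ} (hk : 1 ≤ k) {t : ℝ} (ht : t ∈ Set.Icc (0 : ℝ) 1) :
    h k (hInv k t) = t := Function.invFunOn_eq ((bijOn_h hk).surjOn ht)

/-- The acceptance probability exceeds the threshold by `5 ε / 6`. -/
lemma threshold_add_le {k : ℕ} (hk : 1 ≤ k) {t ε μ : ℝ} (ht : 5 / 6 < t) (ht1 : t ≤ 1)
    (hε : 0 < ε) (hμ : hInv k t + ε ≤ μ) :
    t + 5 / 6 * ε ≤ (∑ i ∈ Finset.range k, (1 + (2 * μ - 1) ^ (i + 1)) / 2) / k := by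
  have htI : t ∈ Set.Icc (0 : ℝ) 1 := ⟨by linarith, ht1⟩
  have hx := hInv_mem hk htI
  have hle := h_le_self hk hx
  have hsub := mul_h_le_h_sub_h hk hx (y := μ) (by linarith)
  rw [h_hInv hk htI] at hle hsub
  -- Here `hle` reads `t ≤ hInv k t`, so `μ > 5/6 > 1/2`.
  have havg := h_le_avg hk (μ := μ) (by linarith)
  have : ε * (5 / 6) ≤ (μ - hInv k t) * t :=
    mul_le_mul (by linarith) ht.le (by norm_num) (by linarith)
  linarith

/-! ### Concentration and conclusion -/

open MeasureTheory ProbabilityTheory in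
/-- Hoeffding's inequality for the winning rate. -/
lemma winningRate_lt_le (P : PMF Bool) {n : ℕ} (hn : 1 ≤ n) {t δ : ℝ} (hδ : 0 ≤ δ)
    (hP : t + δ ≤ (P true).toReal) :
    (Measure.pi fun _ : Fin n => P.toMeasure).real {v | winningRate v < t} ≤
      Real.exp (-(2 * n * δ ^ 2)) := by
  have hn0 : (0 : ℝ) < n := by positivity
  -- The sign turns the lower tail of the winning rate into the upper tail that Hoeffding's
  -- inequality bounds. The range `[-1, 0]` has length 1, which gives the sub-Gaussian parameter
  -- `1/4` per execution.
  let X : Bool → ℝ := fun b => -if b then 1 else 0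
  let m : ℝ := ∫ b, X b ∂P.toMeasure
  have hm : m = -(P true).toReal := by
    simp [m, X, PMF.integral_eq_sum]
  let Y : Fin n → (Fin n → Bool) → ℝ := fun i v => X (v i) - m
  have hsub : HasSubgaussianMGF (fun b => X b - m) ((‖(0 : ℝ) - (-1)‖₊ / 2) ^ 2) P.toMeasure :=
    hasSubgaussianMGF_of_mem_Icc (measurable_of_finite X).aemeasurable
      (Filter.Eventually.of_forall fun b => by cases b <;> simp [X])
  have hind : iIndepFun Y (Measure.pi fun _ : Fin n => P.toMeasure) :=
    iIndepFun_pi (X := fun _ b => X b - m) fun _ => (measurable_of_finite _).aemeasurable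
  have hY : ∀ i ∈ (Finset.univ : Finset (Fin n)), HasSubgaussianMGF (Y i)
      ((‖(0 : ℝ) - (-1)‖₊ / 2) ^ 2) (Measure.pi fun _ : Fin n => P.toMeasure) := by
    intro i _
    refine HasSubgaussianMGF.of_map (Y := fun v : Fin n → Bool => v i)
      (X := fun b => X b - m) (measurable_pi_apply i).aemeasurable ?_
    rwa [(measurePreserving_eval (fun _ : Fin n => P.toMeasure) i).map_eq]
  have hH := HasSubgaussianMGF.measure_sum_ge_le_of_iIndepFun hind hY (ε := n * δ) (by positivity)
  refine (measureReal_mono ?_).trans (hH.trans_eq ?_)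
  · intro v hv
    rw [Set.mem_ofPred_eq, winningRate, div_lt_iff₀ hn0] at hv
    have hs : ∑ i, Y i v = -(∑ i, if v i then (1 : ℝ) else 0) + n * (P true).toReal := by
      simp only [Y, X, Finset.sum_sub_distrib, Finset.sum_neg_distrib, hm]
      simp
    rw [Set.mem_ofPred_eq, hs]
    have := mul_le_mul_of_nonneg_left hP hn0.le
    linarith
  · congr 1
    simp
    field_simp

end PingPong

end

theorem mainTheorem4 (k n : ℕ) (hk : 1 ≤ k) (hn : 1 ≤ n)
    (t ε μ : ℝ) (ht : 5 / 6 < t) (ht1 : t ≤ 1) (hε : 0 < ε)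
    (M : ℕ → PingPong.QubitChannel)
    (hM : ∀ j ∈ Finset.Icc 1 k, ∀ C ∈ PingPong.cliffordGates,
      PingPong.avgFidelity (C.comp (M j)) C = μ)
    (hμ : PingPong.hInv k t + ε ≤ μ) :
    1 - Real.exp (-(n * ε ^ 2)) ≤
      (PingPong.testLaw k hk M n).real {v | t ≤ PingPong.winningRate v} := by
  have hp := PingPong.toReal_executionLaw_true hk M (2 * μ - 1) fun j hj =>
    PingPong.depolParam_eq PingPong.gateX_mem (hM j hj _ PingPong.gateX_mem)
  have hthr := PingPong.threshold_add_le hk ht ht1 hε hμ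
  rw [← hp] at hthr
  have hlt := PingPong.winningRate_lt_le (PingPong.executionLaw k hk M) hn (by positivity) hthr
  -- The constant suffices because `2 * (5/6)² = 25/18 ≥ 1`.
  have hexp : Real.exp (-(2 * n * (5 / 6 * ε) ^ 2)) ≤ Real.exp (-(n * ε ^ 2)) := by
    have : (0 : ℝ) ≤ n * ε ^ 2 := by positivity
    exact Real.exp_le_exp.mpr (by linarith)
  have hcompl : {v : Fin n → Bool | t ≤ PingPong.winningRate v} =
      {v | PingPong.winningRate v < t}ᶜ := by
    ext v
    simp
  rw [hcompl, PingPong.testLaw, MeasureTheory.probReal_compl_eq_one_sub (Set.toFinite _).measurableSet]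
  linarith
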